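/- Let $m, n, q, k, t$ be non-negative integers with $k \ge 1$. An $m \times n$ complex matrix $A$ is called a $(q,k,t)$-design matrix if (1) every row of $A$ has at most $q$ nonzero entries; (2) every column of $A$ has at least $k$ nonzero entries; and (3) for any two distinct columns of $A$ there are at most $t$ rows in which both columns have a nonzero entry. Theorem. If $A$ is an $m \times n$ complex matrix that is a $(q,k,t)$-design matrix and $k \le nt$, then $$\operatorname{rank}(A) \ge n - \frac{6\,m\,n^2\,t^3}{k^4}.$$ -/

import Mathlib

/-- An `m × n` matrix `A` over a field is a `(q, k, t)`-design matrix if every row has at most `q`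
nonzero entries, every column has at least `k` nonzero entries, and the supports of any two
distinct columns meet in at most `t` places. -/
structure IsDesignMatrix {F : Type*} [Field F] {m n : ℕ} (q k t : ℕ)
    (A : Matrix (Fin m) (Fin n) F) : Prop where
  row_le : ∀ i : Fin m, (Function.support (A.row i)).ncard ≤ q
  le_col : ∀ j : Fin n, k ≤ (Function.support (A.col j)).ncard
  inter_le : ∀ j₁ j₂ : Fin n, j₁ ≠ j₂ →
    (Function.support (A.col j₁) ∩ Function.support (A.col j₂)).ncard ≤ t

/-! Spread unit mass uniformly over the support of each column. Rescaling rows and columns keeps the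
rank and gives `B` whose squared moduli have the same row and column sums as these weights
(`exists_scaling`, by convex minimization). The Gram matrix of `B` has unit diagonal and small
off-diagonal entries, so its nullity is at most `t * S`, with `S` the sum of squared row masses.
Counting overlaps gives `S ≤ 2n²t/k²`, and Cauchy–Schwarz on the total mass `n` gives `k² ≤ 2mt`;
together they bound the nullity by `4mn²t³/k⁴`. -/

theorem linear_sub_le_exp_sub {w p : ℝ} (hw : 0 < w) (hp : 0 < p) (z : ℝ) :
    p * |z| - 2 * p ^ 2 / w ≤ w * Real.exp z - p * z := by
  have h0 : 0 ≤ 2 * p ^ 2 / w := by positivity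
  rcases le_total z 0 with hz | hz
  · rw [abs_of_nonpos hz]
    have := mul_pos hw (Real.exp_pos z)
    linarith
  · rw [abs_of_nonneg hz]
    have h1 : w * (1 + z + z ^ 2 / 2) ≤ w * Real.exp z :=
      mul_le_mul_of_nonneg_left (Real.quadratic_le_exp_of_nonneg hz) hw.le
    have h2 : w * z ^ 2 / 2 - 2 * p * z + 2 * p ^ 2 / w = w / 2 * (z - 2 * p / w) ^ 2 := by
      field_simp
      ring
    have h3 : 0 ≤ w / 2 * (z - 2 * p / w) ^ 2 := by positivity
    have h4 : 0 ≤ w * z := mul_nonneg hw.le hz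
    linarith

/-- A critical point of the coercive function `z ↦ ∑ e, (w e * exp (z e) - p e * z e)` restricted to
a subspace. -/
theorem exists_mem_sum_exp_sub_mul_eq_zero {ι : Type*} [Fintype ι] {w p : ι → ℝ}
    (hw : ∀ e, 0 < w e) (hp : ∀ e, 0 < p e) (W : Submodule ℝ (ι → ℝ)) :
    ∃ z ∈ W, ∀ v ∈ W, ∑ e, (w e * Real.exp (z e) - p e) * v e = 0 := by
  classical
  let g : W → ℝ := fun z => ∑ e, (w e * Real.exp (z.1 e) - p e * z.1 e)
  have hg : Continuous g := by
    refine continuous_finsetSum _ fun e _ => ?_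
    have he : Continuous fun z : W => z.1 e := (continuous_apply e).comp continuous_subtype_val
    exact ((Real.continuous_exp.comp he).const_mul _).sub (he.const_mul _)
  -- Each summand grows at least like `p e * |z e|` up to a constant, so a bound on `g` bounds every
  -- coordinate.
  have hb : Bornology.IsBounded {z | g z ≤ g 0} := by
    refine (Metric.isBounded_iff_subset_closedBall 0).2
      ⟨∑ e, (g 0 + ∑ e, 2 * p e ^ 2 / w e) / p e, fun z hz => ?_⟩
    have hC : 0 ≤ g 0 + ∑ e, 2 * p e ^ 2 / w e := by
      refine add_nonneg (Finset.sum_nonneg fun e _ => ?_) (Finset.sum_nonneg fun e _ => ?_)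
      · have := hw e
        simp [this.le]
      · have := hw e
        positivity
    have hC' : ∀ e, 0 ≤ (g 0 + ∑ e, 2 * p e ^ 2 / w e) / p e := fun e => div_nonneg hC (hp e).le
    rw [mem_closedBall_zero_iff, Submodule.coe_norm, pi_norm_le_iff_of_nonneg
      (Finset.sum_nonneg fun e _ => hC' e)]
    intro e
    refine le_trans ?_ (Finset.single_le_sum (fun e _ => hC' e) (Finset.mem_univ e))
    rw [le_div_iff₀ (hp e), Real.norm_eq_abs, mul_comm]
    calc p e * |z.1 e| ≤ ∑ e, p e * |z.1 e| :=
          Finset.single_le_sum (f := fun e => p e * |z.1 e|)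
            (fun e _ => mul_nonneg (hp e).le (abs_nonneg _)) (Finset.mem_univ e)
      _ ≤ ∑ e, ((w e * Real.exp (z.1 e) - p e * z.1 e) + 2 * p e ^ 2 / w e) :=
          Finset.sum_le_sum fun e _ => by
            linarith [linear_sub_le_exp_sub (hw e) (hp e) (z.1 e)]
      _ = g z + ∑ e, 2 * p e ^ 2 / w e := Finset.sum_add_distrib
      _ ≤ _ := by gcongr; exact hz
  obtain ⟨z, hz⟩ := hg.exists_forall_le_of_isBounded 0 hb
  refine ⟨z, z.2, fun v hv => ?_⟩
  let h : ℝ → ℝ := fun s => ∑ e, (w e * Real.exp (z.1 e + s * v e) - p e * (z.1 e + s * v e))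
  have hmin : IsLocalMin h 0 := by
    refine Filter.Eventually.of_forall fun s => ?_
    have := hz (z + s • ⟨v, hv⟩)
    simpa [g, h] using this
  have hd : HasDerivAt h (∑ e, (w e * Real.exp (z.1 e) - p e) * v e) 0 := by
    refine HasDerivAt.fun_sum fun e _ => ?_
    have h1 : HasDerivAt (fun s : ℝ => z.1 e + s * v e) (v e) 0 := by
      simpa using ((hasDerivAt_id (0 : ℝ)).mul_const (v e)).const_add (z.1 e)
    have h2 := (h1.exp.const_mul (w e)).sub (h1.const_mul (p e))
    refine h2.congr_deriv ?_
    simp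
    ring
  exact hmin.hasDerivAt_eq_zero hd

/-- Matrix scaling: a nonnegative matrix can be scaled to have the row and column sums of any
nonnegative matrix with the same support. -/
theorem exists_scaling {m n : Type*} [Fintype m] [Fintype n] {w p : m → n → ℝ}
    (hw : ∀ i j, 0 ≤ w i j) (hp : ∀ i j, 0 ≤ p i j) (h : ∀ i j, w i j = 0 ↔ p i j = 0) :
    ∃ (x : m → ℝ) (y : n → ℝ),
      (∀ i, ∑ j, w i j * Real.exp (x i + y j) = ∑ j, p i j) ∧
      ∀ j, ∑ i, w i j * Real.exp (x i + y j) = ∑ i, p i j := by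
  classical
  let ι := {e : m × n // w e.1 e.2 ≠ 0}
  -- Criticality on the space of exponents `x i + y j` over the support is the marginal condition,
  -- read off by testing on row and column indicators.
  let L : (m → ℝ) × (n → ℝ) →ₗ[ℝ] (ι → ℝ) :=
    { toFun := fun u e => u.1 e.1.1 + u.2 e.1.2
      map_add' := fun u v => by ext; simp; ring
      map_smul' := fun c u => by ext; simp; ring }
  obtain ⟨_, ⟨⟨x, y⟩, rfl⟩, hz⟩ := exists_mem_sum_exp_sub_mul_eq_zero
    (ι := ι) (w := fun e => w e.1.1 e.1.2) (p := fun e => p e.1.1 e.1.2)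
    (fun e => (hw _ _).lt_of_ne' e.2) (fun e => (hp _ _).lt_of_ne' fun h0 => e.2 ((h _ _).2 h0))
    (LinearMap.range L)
  have key : ∀ (a : m → ℝ) (b : n → ℝ),
      ∑ i, ∑ j, (w i j * Real.exp (x i + y j) - p i j) * (a i + b j) = 0 := by
    intro a b
    rw [← Fintype.sum_prod_type'
      (f := fun i j => (w i j * Real.exp (x i + y j) - p i j) * (a i + b j)),
      ← hz (L (a, b)) ⟨_, rfl⟩]
    rw [← Fintype.sum_subtype_add_sum_subtype (fun e : m × n => w e.1 e.2 ≠ 0)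
      (fun e => (w e.1 e.2 * Real.exp (x e.1 + y e.2) - p e.1 e.2) * (a e.1 + b e.2))]
    refine (add_eq_left.2 <| Finset.sum_eq_zero fun e _ => ?_).trans ?_
    · have h0 : w e.1.1 e.1.2 = 0 := not_not.1 e.2
      simp [h0, (h _ _).1 h0]
    · rfl
  refine ⟨x, y, fun i => ?_, fun j => ?_⟩
  · have := key (Pi.single i 1) 0
    rw [Finset.sum_eq_single i (by intro b _ hb; simp [hb]) (by simp)] at this
    simpa [sub_eq_zero] using this
  · have := key 0 (Pi.single j 1)
    rw [Finset.sum_comm, Finset.sum_eq_single j (by intro b _ hb; simp [hb]) (by simp)] at this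
    simpa [sub_eq_zero] using this

open Matrix ComplexOrder in
/-- The nullity of a Hermitian matrix is at most its squared Frobenius distance to the identity. -/
theorem Matrix.IsHermitian.card_sub_rank_le {n : Type*} [Fintype n] [DecidableEq n]
    {M : Matrix n n ℂ} (hM : M.IsHermitian) :
    (Fintype.card n : ℝ) - M.rank ≤ ∑ i, ∑ j, ‖(M - 1) i j‖ ^ 2 := by
  -- In this form each zero eigenvalue contributes exactly 1.
  have hfrob : (∑ i, ∑ j, ‖(M - 1) i j‖ ^ 2 : ℝ) = ∑ i, (hM.eigenvalues i - 1) ^ 2 := by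
    have h1 : M - 1 = Unitary.conjStarAlgAut ℂ _ hM.eigenvectorUnitary
        (diagonal fun i => ((hM.eigenvalues i - 1 : ℝ) : ℂ)) := by
      conv_lhs => rw [hM.spectral_theorem]
      rw [← map_one (Unitary.conjStarAlgAut ℂ _ hM.eigenvectorUnitary), ← map_sub,
        ← diagonal_one, diagonal_sub]
      congr 2
      ext i
      simp
    have h2 : trace ((M - 1) * (M - 1)) = ∑ i, ((hM.eigenvalues i - 1 : ℝ) : ℂ) ^ 2 := by
      conv_lhs => rw [h1]
      rw [← map_mul, Unitary.conjStarAlgAut_apply, trace_mul_cycle, Unitary.coe_star_mul_self,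
        one_mul, diagonal_mul_diagonal, trace_diagonal]
      simp [sq]
    have h3 : (M - 1)ᴴ = M - 1 := hM.sub isHermitian_one
    have h4 : trace ((M - 1) * (M - 1)) = ((∑ i, ∑ j, ‖(M - 1) i j‖ ^ 2 : ℝ) : ℂ) := by
      nth_rewrite 2 [← h3]
      simp only [trace, diag_apply, mul_apply, conjTranspose_apply]
      push_cast
      refine Finset.sum_congr rfl fun i _ => Finset.sum_congr rfl fun j _ => ?_
      exact Complex.mul_conj' _
    rw [h4] at h2
    exact_mod_cast h2
  rw [hfrob, hM.rank_eq_card_non_zero_eigs, Fintype.card_subtype, sub_le_iff_le_add,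
    Finset.card_filter, ← Finset.card_univ, Finset.card_eq_sum_ones]
  push_cast
  rw [← Finset.sum_add_distrib]
  refine Finset.sum_le_sum fun i _ => ?_
  split_ifs with h
  · nlinarith [sq_nonneg (hM.eigenvalues i - 1)]
  · rw [not_not] at h
    simp [h]

open scoped ComplexOrder in
/-- The rank bound for matrices with unit columns and small overlaps of column supports. -/
theorem Matrix.card_sub_rank_le_of_unit_columns {m n : Type*} [Fintype m] [Fintype n]
    {B : Matrix m n ℂ} {t : ℕ}
    (hcol : ∀ j, ∑ i, ‖B i j‖ ^ 2 = 1)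
    (ht : ∀ j₁ j₂, j₁ ≠ j₂ → {i | B i j₁ ≠ 0 ∧ B i j₂ ≠ 0}.ncard ≤ t) :
    (Fintype.card n : ℝ) - t * ∑ i, (∑ j, ‖B i j‖ ^ 2) ^ 2 ≤ B.rank := by
  classical
  have key := (Matrix.isHermitian_conjTranspose_mul_self B).card_sub_rank_le
  rw [Matrix.rank_conjTranspose_mul_self] at key
  suffices h : ∀ j₁ j₂, ‖(B.conjTranspose * B - 1 : Matrix n n ℂ) j₁ j₂‖ ^ 2 ≤
      t * ∑ i, ‖B i j₁‖ ^ 2 * ‖B i j₂‖ ^ 2 by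
    have h2 : ∑ j₁, ∑ j₂, ‖(B.conjTranspose * B - 1 : Matrix n n ℂ) j₁ j₂‖ ^ 2 ≤
        t * ∑ i, (∑ j, ‖B i j‖ ^ 2) ^ 2 := by
      calc _ ≤ ∑ j₁, ∑ j₂, t * ∑ i, ‖B i j₁‖ ^ 2 * ‖B i j₂‖ ^ 2 :=
            Finset.sum_le_sum fun j₁ _ => Finset.sum_le_sum fun j₂ _ => h j₁ j₂
        _ = _ := by
            simp_rw [← Finset.mul_sum, sq (∑ j, _), Finset.sum_mul_sum]
            congr 1
            rw [Finset.sum_comm]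
            simp_rw [Finset.sum_comm (s := (Finset.univ : Finset n)) (t := (Finset.univ : Finset m))]
            refine Finset.sum_congr rfl fun i _ => Finset.sum_comm
    linarith
  intro j₁ j₂
  have hnn : 0 ≤ ∑ i, ‖B i j₁‖ ^ 2 * ‖B i j₂‖ ^ 2 := Finset.sum_nonneg fun i _ => by positivity
  rcases eq_or_ne j₁ j₂ with rfl | hne
  · have : (B.conjTranspose * B) j₁ j₁ = 1 := by
      simp only [Matrix.mul_apply, Matrix.conjTranspose_apply, Complex.star_def,
        Complex.conj_mul']
      exact_mod_cast hcol j₁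
    rw [Matrix.sub_apply, this, Matrix.one_apply_eq]
    simp
    positivity
  · rw [Matrix.sub_apply, Matrix.one_apply_ne hne, sub_zero, Matrix.mul_apply]
    let T : Finset m := {i | B i j₁ ≠ 0 ∧ B i j₂ ≠ 0}
    have hT : (T.card : ℝ) ≤ t := by
      have := ht j₁ j₂ hne
      rw [← Set.ncard_coe_finset]
      simpa [T] using this
    have hsum : ∑ i, B.conjTranspose j₁ i * B i j₂ = ∑ i ∈ T, B.conjTranspose j₁ i * B i j₂ := by
      symm
      refine Finset.sum_subset (Finset.subset_univ _) fun i _ hi => ?_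
      have : B i j₁ = 0 ∨ B i j₂ = 0 := by
        by_contra! hc
        exact hi (by simpa [T] using hc)
      rcases this with h | h <;> simp [h]
    -- Cauchy–Schwarz over the at most `t` common rows produces the factor `t`.
    calc ‖∑ i, B.conjTranspose j₁ i * B i j₂‖ ^ 2
        ≤ (∑ i ∈ T, ‖B i j₁‖ * ‖B i j₂‖) ^ 2 := by
          rw [hsum]
          gcongr
          refine (norm_sum_le _ _).trans (Finset.sum_le_sum fun i _ => ?_)
          simp
      _ ≤ T.card * ∑ i ∈ T, (‖B i j₁‖ * ‖B i j₂‖) ^ 2 := sq_sum_le_card_mul_sum_sq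
      _ ≤ t * ∑ i, ‖B i j₁‖ ^ 2 * ‖B i j₂‖ ^ 2 := by
          simp_rw [mul_pow]
          gcongr
          exact Finset.subset_univ _

/-- The rank bound obtained by scaling `A` to prescribed nonnegative weights with unit column sums. -/
theorem Matrix.card_sub_rank_le_of_weights {m n : Type*} [Fintype m] [Fintype n]
    {A : Matrix m n ℂ} {t : ℕ} {p : m → n → ℝ} (hp : ∀ i j, 0 ≤ p i j)
    (h : ∀ i j, A i j = 0 ↔ p i j = 0) (hcol : ∀ j, ∑ i, p i j = 1)
    (ht : ∀ j₁ j₂, j₁ ≠ j₂ → {i | A i j₁ ≠ 0 ∧ A i j₂ ≠ 0}.ncard ≤ t) :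
    (Fintype.card n : ℝ) - t * ∑ i, (∑ j, p i j) ^ 2 ≤ A.rank := by
  classical
  obtain ⟨x, y, hx, hy⟩ := exists_scaling (w := fun i j => ‖A i j‖ ^ 2) (p := p)
    (fun i j => by positivity) hp (fun i j => by simp [h])
  -- Exponents are halved because the scaling applies to squared moduli.
  let B : Matrix m n ℂ := Matrix.diagonal (fun i => (Real.exp (x i / 2) : ℂ)) * A *
    Matrix.diagonal (fun j => (Real.exp (y j / 2) : ℂ))
  have hB : ∀ i j, B i j = Real.exp (x i / 2) * A i j * Real.exp (y j / 2) := fun i j => by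
    simp only [B, Matrix.mul_diagonal, Matrix.diagonal_mul]
  have hnorm : ∀ i j, ‖B i j‖ ^ 2 = ‖A i j‖ ^ 2 * Real.exp (x i + y j) := fun i j => by
    have h1 : Real.exp (x i + y j) = (Real.exp (x i / 2) * Real.exp (y j / 2)) ^ 2 := by
      rw [← Real.exp_add, ← Real.exp_nat_mul]
      congr 1
      push_cast
      ring
    rw [hB, h1, norm_mul, norm_mul, Complex.norm_real, Complex.norm_real, Real.norm_eq_abs,
      Real.norm_eq_abs, Real.abs_exp, Real.abs_exp]
    ring
  have hzero : ∀ i j, B i j = 0 ↔ A i j = 0 := fun i j => by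
    rw [hB]
    simp [-Complex.ofReal_exp, Real.exp_ne_zero]
  have hrank : B.rank = A.rank := by
    rw [Matrix.rank_mul_eq_left_of_isUnit_det, Matrix.rank_mul_eq_right_of_isUnit_det] <;>
    · rw [Matrix.det_diagonal, isUnit_iff_ne_zero, Finset.prod_ne_zero_iff]
      exact fun i _ => Complex.ofReal_ne_zero.2 (Real.exp_ne_zero _)
  have key := Matrix.card_sub_rank_le_of_unit_columns (B := B) (t := t)
    (fun j => by simp_rw [hnorm, hy, hcol]) (fun j₁ j₂ hj => by simpa [hzero] using ht j₁ j₂ hj)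
  simpa only [hnorm, hx, hrank] using key

/-- The weights `1 / (number of nonzero entries of the column)` on the nonzero entries. -/
theorem sum_sq_column_weights_le {F m n : Type*} [Field F] [DecidableEq F] [Fintype m] [Fintype n]
    {A : Matrix m n F} {k t : ℕ} (hk : 0 < k) (d : n → ℕ)
    (hd : ∀ j, d j = (Finset.univ.filter fun i => A i j ≠ 0).card) (hkd : ∀ j, k ≤ d j)
    (ht : ∀ j₁ j₂, j₁ ≠ j₂ → (Finset.univ.filter fun i => A i j₁ ≠ 0 ∧ A i j₂ ≠ 0).card ≤ t) :
    ∑ i, (∑ j, if A i j = 0 then (0 : ℝ) else (d j : ℝ)⁻¹) ^ 2 ≤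
      Fintype.card n / k + Fintype.card n ^ 2 * t / k ^ 2 := by
  classical
  have hk' : (0 : ℝ) < k := by exact_mod_cast hk
  have hdk : ∀ j, (d j : ℝ)⁻¹ ≤ (k : ℝ)⁻¹ := fun j =>
    inv_anti₀ hk' (by exact_mod_cast hkd j)
  -- Equal columns give `d * d⁻² = d⁻¹ ≤ k⁻¹`; distinct ones share at most `t` rows, each
  -- contributing at most `k⁻²`.
  have hpair : ∀ j₁ j₂, ∑ i, (if A i j₁ = 0 then (0 : ℝ) else (d j₁ : ℝ)⁻¹) *
      (if A i j₂ = 0 then (0 : ℝ) else (d j₂ : ℝ)⁻¹) ≤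
      (if j₁ = j₂ then (k : ℝ)⁻¹ else 0) + t / k ^ 2 := by
    intro j₁ j₂
    have h1 : ∑ i, (if A i j₁ = 0 then (0 : ℝ) else (d j₁ : ℝ)⁻¹) *
        (if A i j₂ = 0 then (0 : ℝ) else (d j₂ : ℝ)⁻¹) =
        (Finset.univ.filter fun i => A i j₁ ≠ 0 ∧ A i j₂ ≠ 0).card *
          ((d j₁ : ℝ)⁻¹ * (d j₂ : ℝ)⁻¹) := by
      rw [← nsmul_eq_mul, ← Finset.sum_const, Finset.sum_filter]
      refine Finset.sum_congr rfl fun i _ => ?_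
      by_cases h₁ : A i j₁ = 0 <;> by_cases h₂ : A i j₂ = 0 <;> simp [h₁, h₂]
    rw [h1]
    split_ifs with h
    · subst h
      have hpos : (0 : ℝ) < d j₁ := hk'.trans_le (by exact_mod_cast hkd j₁)
      simp only [and_self]
      rw [← hd, ← mul_assoc, mul_inv_cancel₀ hpos.ne', one_mul]
      have : (0 : ℝ) ≤ t / k ^ 2 := by positivity
      linarith [hdk j₁]
    · have h2 := ht j₁ j₂ h
      have h3 : ((Finset.univ.filter fun i => A i j₁ ≠ 0 ∧ A i j₂ ≠ 0).card : ℝ) ≤ t := by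
        exact_mod_cast h2
      rw [zero_add, div_eq_mul_inv, sq, mul_inv]
      exact mul_le_mul h3 (mul_le_mul (hdk _) (hdk _) (by positivity) (by positivity))
        (by positivity) (by positivity)
  calc _ = ∑ j₁, ∑ j₂, ∑ i, (if A i j₁ = 0 then (0 : ℝ) else (d j₁ : ℝ)⁻¹) *
      (if A i j₂ = 0 then (0 : ℝ) else (d j₂ : ℝ)⁻¹) := by
        simp_rw [sq, Finset.sum_mul_sum]
        rw [Finset.sum_comm]
        exact Finset.sum_congr rfl fun j _ => Finset.sum_comm
    _ ≤ ∑ j₁ : n, ∑ j₂ : n, ((if j₁ = j₂ then (k : ℝ)⁻¹ else 0) + t / k ^ 2) :=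
        Finset.sum_le_sum fun j₁ _ => Finset.sum_le_sum fun j₂ _ => hpair j₁ j₂
    _ = _ := by
        simp [Finset.sum_add_distrib]
        ring

theorem mainTheorem3 (m n q k t : ℕ) (A : Matrix (Fin m) (Fin n) ℂ)
    (hA : IsDesignMatrix q k t A) (hk : 0 < k) (hkt : k ≤ n * t) :
    (n : ℝ) - 6 * (m : ℝ) * (n : ℝ) ^ 2 * (t : ℝ) ^ 3 / (k : ℝ) ^ 4 ≤ (A.rank : ℝ) := by
  classical
  let d : Fin n → ℕ := fun j => (Finset.univ.filter fun i => A i j ≠ 0).card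
  have hcard : ∀ j, (Function.support (A.col j)).ncard = d j := fun j => by
    simp only [d]
    rw [← Set.ncard_coe_finset]
    congr 1
    ext i
    simp
  have hkd : ∀ j, k ≤ d j := fun j => (hA.le_col j).trans_eq (hcard j)
  have hd0 : ∀ j, (d j : ℝ) ≠ 0 := fun j => by
    have := hkd j
    exact_mod_cast (by lia : d j ≠ 0)
  have ht : ∀ j₁ j₂, j₁ ≠ j₂ → {i | A i j₁ ≠ 0 ∧ A i j₂ ≠ 0}.ncard ≤ t := hA.inter_le
  let p : Fin m → Fin n → ℝ := fun i j => if A i j = 0 then 0 else (d j : ℝ)⁻¹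
  have hcol : ∀ j, ∑ i, p i j = 1 := fun j => by
    simp only [p]
    simp_rw [← ite_not (A _ j = 0)]
    rw [← Finset.sum_filter, Finset.sum_const, nsmul_eq_mul]
    exact mul_inv_cancel₀ (hd0 j)
  have h1 := A.card_sub_rank_le_of_weights (p := p)
    (fun i j => by simp only [p]; split_ifs <;> positivity)
    (fun i j => by simp [p, hd0]) hcol ht
  have h2 := sum_sq_column_weights_le (A := A) (t := t) hk d (fun _ => rfl) hkd
    (fun j₁ j₂ hj => by
      rw [← Set.ncard_coe_finset]
      simpa using ht j₁ j₂ hj)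
  change ∑ i, (∑ j, p i j) ^ 2 ≤ _ at h2
  have h3 : (n : ℝ) ^ 2 ≤ m * ∑ i, (∑ j, p i j) ^ 2 := by
    have h4 : ∑ i, ∑ j, p i j = n := by
      rw [Finset.sum_comm]
      simp [hcol]
    have := sq_sum_le_card_mul_sum_sq (s := Finset.univ) (f := fun i => ∑ j, p i j)
    simpa [h4] using this
  rw [Fintype.card_fin] at h1 h2
  set S := ∑ i, (∑ j, p i j) ^ 2
  have hk' : (0 : ℝ) < k := by exact_mod_cast hk
  have hkt' : (k : ℝ) ≤ n * t := by exact_mod_cast hkt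
  have hn : (0 : ℝ) < n := by
    rcases Nat.eq_zero_or_pos n with rfl | h
    · lia
    · exact_mod_cast h
  -- Here `k ≤ n * t` absorbs the diagonal term `n * k` into `n² * t`.
  have hS : S * k ^ 2 ≤ 2 * n ^ 2 * t := by
    have : (n / k + n ^ 2 * t / k ^ 2 : ℝ) * k ^ 2 = n * k + n ^ 2 * t := by
      field_simp
    nlinarith [mul_le_mul_of_nonneg_right h2 (sq_nonneg (k : ℝ)),
      mul_le_mul_of_nonneg_left hkt' hn.le]
  have hm : (k : ℝ) ^ 2 ≤ 2 * m * t := by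
    have h5 : (n : ℝ) ^ 2 * k ^ 2 ≤ n ^ 2 * (2 * m * t) :=
      calc (n : ℝ) ^ 2 * k ^ 2 ≤ m * S * k ^ 2 := by gcongr
        _ = m * (S * k ^ 2) := by ring
        _ ≤ m * (2 * n ^ 2 * t) := by gcongr
        _ = _ := by ring
    exact le_of_mul_le_mul_left h5 (by positivity)
  -- The bound `t * S ≤ 2n²t²/k²` is weakened by the factor `2mt/k² ≥ 1`; the constant 4 already
  -- suffices.
  suffices h6 : t * S ≤ 6 * (m : ℝ) * n ^ 2 * t ^ 3 / k ^ 4 by linarith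
  rw [le_div_iff₀ (by positivity)]
  calc (t : ℝ) * S * (k : ℝ) ^ 4 = t * (S * (k : ℝ) ^ 2) * (k : ℝ) ^ 2 := by ring
    _ ≤ (t : ℝ) * (2 * n ^ 2 * t) * (2 * m * t) := by gcongr
    _ = 4 * ((m : ℝ) * n ^ 2 * t ^ 3) := by ring
    _ ≤ 6 * ((m : ℝ) * n ^ 2 * t ^ 3) := by gcongr; norm_num
    _ = _ := by ring
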